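/- **Setting.** Let $m,n,l\ge 0$ and $K\ge 1$ be integers, $\mathcal X\subseteq\mathbb R^n$, $\gamma_1\ge 0$, $\gamma_2\ge 1$, $\boldsymbol\mu\in\mathbb R^m$, and let $\boldsymbol\Sigma\succ 0$ be an $m\times m$ matrix with eigenvalue decomposition $\boldsymbol\Sigma=\mathbf U\boldsymbol\Lambda\mathbf U^\top$ ($\mathbf U$ orthogonal, $\boldsymbol\Lambda$ diagonal). Let $f(\mathbf x,\boldsymbol\xi)=\max_{k\in[K]}\{y_k^0(\mathbf x)+y_k(\mathbf x)^\top\boldsymbol\xi\}$ with $y_k^0:\mathbb R^n\to\mathbb R$ and $y_k:\mathbb R^n\to\mathbb R^m$ affine, let $\mathcal S=\{\boldsymbol\xi\in\mathbb R^m:\mathbf A\boldsymbol\xi\le\mathbf b\}$ with $\mathbf A\in\mathbb R^{l\times m}$, $\mathbf b\in\mathbb R^l$ have an interior point, and let $\mathcal S_{\mathrm I}=\{\boldsymbol\xi:\mathbf U\boldsymbol\Lambda^{1/2}\boldsymbol\xi+\boldsymbol\mu\in\mathcal S\}$. For $m_1\le m$ let $\mathcal B_{m_1}=\{\mathbf B\in\mathbb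 R^{m\times m_1}:\mathbf B^\top\mathbf B=\mathbf I_{m_1}\}$. Let $\mathcal D_{\mathrm M}$ be the set of probability distributions $\mathbb P$ on $\mathbb R^m$ with $\mathbb P(\boldsymbol\xi\in\mathcal S_{\mathrm I})=1$, $\mathbb E_{\mathbb P}[\boldsymbol\xi]^\top\mathbb E_{\mathbb P}[\boldsymbol\xi]\le\gamma_1$ and $\mathbb E_{\mathbb P}[\boldsymbol\xi\boldsymbol\xi^\top]\preceq\gamma_2\mathbf I_m$, and for $\mathbf B\in\mathcal B_{m_1}$ let $\mathcal D_{\mathrm U}(\mathbf B)$ be defined in the same way with the last constraint relaxed to $\mathbb E_{\mathbb P}[\mathbf B^\top\boldsymbol\xi\boldsymbol\xi^\top\mathbf B]\preceq\gamma_2\mathbf I_{m_1}$ (the moments in the constraints are required to exist). Define, as infima and suprema in $[-\infty,\infty]$, $$\Theta_{\mathrm M}(m)=\min_{\mathbf x\in\mathcal X}\max_{\mathbb P\in\mathcal D_{\mathrm M}}\mathbb E_{\mathbb P}[f(\mathbf x,\mathbf U\boldsymbol\Lambda^{1/2}\boldsymbol\xi+\boldsymbol\mu)],\quad \overline\Theta(m_1,\mathbf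 B)=\min_{\mathbf x\in\mathcal X}\max_{\mathbb P\in\mathcal D_{\mathrm U}(\mathbf B)}\mathbb E_{\mathbb P}[f(\mathbf x,\mathbf U\boldsymbol\Lambda^{1/2}\boldsymbol\xi+\boldsymbol\mu)],\quad \Theta_{\mathrm U}(m_1)=\min_{\mathbf B\in\mathcal B_{m_1}}\overline\Theta(m_1,\mathbf B).$$ For $\mathbf x\in\mathbb R^n$, $s\in\mathbb R$ and $\hat{\boldsymbol\lambda}=(\boldsymbol\lambda_1,\dots,\boldsymbol\lambda_K)$ with $\boldsymbol\lambda_k\in\mathbb R^l_+$ write $S_k=s-y_k^0(\mathbf x)-\boldsymbol\lambda_k^\top\mathbf b-y_k(\mathbf x)^\top\boldsymbol\mu+\boldsymbol\lambda_k^\top\mathbf A\boldsymbol\mu$ and $\mathbf c_k=(\mathbf U\boldsymbol\Lambda^{1/2})^\top(\mathbf A^\top\boldsymbol\lambda_k-y_k(\mathbf x))$. The *original SDP* is to minimize $s+\gamma_2\,\mathrm{tr}(\mathbf Q)+\sqrt{\gamma_1}\,\|\mathbf q\|_2$ over $\mathbf x\in\mathcal X$, $s$, $\hat{\boldsymbol\lambda}\ge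 0$, $\mathbf q\in\mathbb R^m$, $\mathbf Q\in\mathbb R^{m\times m}$ subject to $\begin{bmatrix}S_k&\frac12(\mathbf q+\mathbf c_k)^\top\\ \frac12(\mathbf q+\mathbf c_k)&\mathbf Q\end{bmatrix}\succeq 0$ for all $k\in[K]$. The *inner SDP* for $\mathbf B\in\mathcal B_{m_1}$ is to minimize $s+\gamma_2\,\mathrm{tr}(\mathbf Q_{\mathrm r})+\sqrt{\gamma_1}\,\|\mathbf q\|_2$ over $\mathbf x\in\mathcal X$, $s$, $\hat{\boldsymbol\lambda}\ge 0$, $\mathbf q\in\mathbb R^m$, $\mathbf Q_{\mathrm r}\in\mathbb R^{m_1\times m_1}$, $\mathbf u_k\in\mathbb R^{m_1}$ subject to $\begin{bmatrix}S_k&\frac12\mathbf u_k^\top\\ \frac12\mathbf u_k&\mathbf Q_{\mathrm r}\end{bmatrix}\succeq 0$ and $\mathbf q+\mathbf c_k=\mathbf B\mathbf u_k$ for all $k\in[K]$. **Theorem.** 1. If $K\le m_1\le m$, then $\Theta_{\mathrm U}(m_1)=\Theta_{\mathrm M}(m)$; and the infimum over $\mathbf B\in\mathcal B_{m_1}$ of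 the optimal value of the inner SDP also equals $\Theta_{\mathrm M}(m)$. 2. Call $(\mathbf V,\boldsymbol\delta,\mathbf Y_{11},(\boldsymbol\nu_k)_{k\in[K]})$ *low-rank data* of an optimal solution $(\mathbf x^*,s^*,\hat{\boldsymbol\lambda}^*,\mathbf q',\mathbf Q')$ of the original SDP if $\mathbf V\in\mathcal B_K$, $\mathbf q'=\mathbf V\boldsymbol\delta$, $\mathbf Q'=\mathbf V\mathbf Y_{11}\mathbf V^\top$ with $\mathbf Y_{11}\in\mathbb R^{K\times K}$, $\mathbf Y_{11}\succeq 0$, and $(\mathbf U\boldsymbol\Lambda^{1/2})^\top(\mathbf A^\top\boldsymbol\lambda_k^*-y_k(\mathbf x^*))=\mathbf V\boldsymbol\nu_k$ for all $k\in[K]$. If $K\le m$, then for every optimal solution $(\mathbf x^*,s^*,\hat{\boldsymbol\lambda}^*,\mathbf q^*,\mathbf Q^*)$ of the original SDP there is an optimal solution $(\mathbf x^*,s^*,\hat{\boldsymbol\lambda}^*,\mathbf q',\mathbf Q')$ that has low-rank data. 3. Let $m_1=K$. For every optimal solution of the original SDP with low-rank data as above, $\mathbf B=\mathbf V$ and $\mathbf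 Q_{\mathrm r}=\mathbf Y_{11}$ are optimal: $\Theta_{\mathrm U}(K)=\overline\Theta(K,\mathbf V)$, and there is a feasible point of the inner SDP for $\mathbf B=\mathbf V$ with $\mathbf Q_{\mathrm r}=\mathbf Y_{11}$ whose objective value equals $\Theta_{\mathrm U}(K)$ and is minimal among all feasible points of the inner SDPs for all $\mathbf B\in\mathcal B_K$. -/

import Mathlib

open MeasureTheory

noncomputable section

namespace ODR

/-- The data of a moment-based distributionally robust optimization problem: a feasible set `X` of
decisions in `ℝⁿ`, `K` pieces that are affine in the decision, a polyhedron `{ξ | A ξ ≤ b}` in `ℝᵐ`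
with `l` inequalities, a mean `μ`, a covariance matrix `Sig` with factors `U` (orthogonal) and `Lam`
(the diagonal of the diagonal factor), and two sizes `γ₁`, `γ₂`. No property is imposed here. -/
structure Data (m n K l : ℕ) where
  X : Set (Fin n → ℝ)
  y₀ : Fin K → ((Fin n → ℝ) →ᵃ[ℝ] ℝ)
  y : Fin K → ((Fin n → ℝ) →ᵃ[ℝ] (Fin m → ℝ))
  A : Matrix (Fin l) (Fin m) ℝ
  b : Fin l → ℝ
  μ : Fin m → ℝ
  Sig : Matrix (Fin m) (Fin m) ℝ
  U : Matrix (Fin m) (Fin m) ℝ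
  Lam : Fin m → ℝ
  γ₁ : ℝ
  γ₂ : ℝ

/-- `𝓑_{m₁}`: the `m × m₁` matrices with orthonormal columns. -/
def orthoFrames (m m₁ : ℕ) : Set (Matrix (Fin m) (Fin m₁) ℝ) :=
  {B | B.transpose * B = 1}

/-- The mean vector `E_P[ξ]`. -/
def meanVec {m : ℕ} (P : Measure (Fin m → ℝ)) : Fin m → ℝ :=
  fun i => ∫ ξ, ξ i ∂P

/-- The matrix `E_P[g(ξ) g(ξ)ᵀ]`. -/
def secondMoment {m r : ℕ} (P : Measure (Fin m → ℝ)) (g : (Fin m → ℝ) → (Fin r → ℝ)) :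
    Matrix (Fin r) (Fin r) ℝ :=
  Matrix.of fun i j => ∫ ξ, g ξ i * g ξ j ∂P

/-- The symmetric block matrix `[[a, ½ wᵀ], [½ w, Q]]`. -/
def blockMatrix {r : ℕ} (a : ℝ) (w : Fin r → ℝ) (Q : Matrix (Fin r) (Fin r) ℝ) :
    Matrix (Unit ⊕ Fin r) (Unit ⊕ Fin r) ℝ :=
  Matrix.fromBlocks (Matrix.of fun _ _ => a) (Matrix.replicateRow Unit ((1 / 2 : ℝ) • w))
    (Matrix.replicateCol Unit ((1 / 2 : ℝ) • w)) Q

namespace Data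

/-- The polyhedral support `𝓢 = {ξ | A ξ ≤ b}`. -/
def S {m n K l : ℕ} (D : Data m n K l) : Set (Fin m → ℝ) :=
  {ξ | D.A.mulVec ξ ≤ D.b}

/-- The piecewise linear cost `f(x, ξ) = max_k (y_k⁰(x) + y_k(x)ᵀ ξ)`. -/
def f {m n K l : ℕ} (D : Data m n K l) (x : Fin n → ℝ) (ξ : Fin m → ℝ) : ℝ :=
  ⨆ k : Fin K, (D.y₀ k x + D.y k x ⬝ᵥ ξ)

/-- The matrix `U Λ^{1/2}`. -/
def L {m n K l : ℕ} (D : Data m n K l) : Matrix (Fin m) (Fin m) ℝ :=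
  D.U * Matrix.diagonal fun i => √(D.Lam i)

/-- The transformed support `𝓢_I = {ξ | U Λ^{1/2} ξ + μ ∈ 𝓢}`. -/
def SI {m n K l : ℕ} (D : Data m n K l) : Set (Fin m → ℝ) :=
  {ξ | D.L.mulVec ξ + D.μ ∈ D.S}

/-- The ambiguity set `𝓓_M`. The moments that occur in the constraints are required to exist. -/
def DM {m n K l : ℕ} (D : Data m n K l) : Set (ProbabilityMeasure (Fin m → ℝ)) :=
  {P | (∀ᵐ ξ ∂(P : Measure (Fin m → ℝ)), ξ ∈ D.SI) ∧
    (∀ i, Integrable (fun ξ => ξ i) (P : Measure (Fin m → ℝ))) ∧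
    meanVec (P : Measure (Fin m → ℝ)) ⬝ᵥ meanVec (P : Measure (Fin m → ℝ)) ≤ D.γ₁ ∧
    (∀ i j, Integrable (fun ξ => ξ i * ξ j) (P : Measure (Fin m → ℝ))) ∧
    (D.γ₂ • (1 : Matrix (Fin m) (Fin m) ℝ) -
      secondMoment (P : Measure (Fin m → ℝ)) (fun ξ => ξ)).PosSemidef}

/-- The relaxed ambiguity set `𝓓_U` for the matrix `B`: only the second moments of `Bᵀ ξ` are
constrained. The moments that occur in the constraints are required to exist. -/
def DU {m n K l : ℕ} (D : Data m n K l) {m₁ : ℕ} (B : Matrix (Fin m) (Fin m₁) ℝ) :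
    Set (ProbabilityMeasure (Fin m → ℝ)) :=
  {P | (∀ᵐ ξ ∂(P : Measure (Fin m → ℝ)), ξ ∈ D.SI) ∧
    (∀ i, Integrable (fun ξ => ξ i) (P : Measure (Fin m → ℝ))) ∧
    meanVec (P : Measure (Fin m → ℝ)) ⬝ᵥ meanVec (P : Measure (Fin m → ℝ)) ≤ D.γ₁ ∧
    (∀ i j, Integrable (fun ξ => B.transpose.mulVec ξ i * B.transpose.mulVec ξ j)
      (P : Measure (Fin m → ℝ))) ∧
    (D.γ₂ • (1 : Matrix (Fin m₁) (Fin m₁) ℝ) -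
      secondMoment (P : Measure (Fin m → ℝ)) (fun ξ => B.transpose.mulVec ξ)).PosSemidef}

/-- The expected cost `E_P[f(x, U Λ^{1/2} ξ + μ)]`. The integrand is Lipschitz in `ξ`, hence
integrable for every `P` in `DM` or `DU`. -/
def cost {m n K l : ℕ} (D : Data m n K l) (x : Fin n → ℝ) (P : ProbabilityMeasure (Fin m → ℝ)) :
    ℝ :=
  ∫ ξ, D.f x (D.L.mulVec ξ + D.μ) ∂(P : Measure (Fin m → ℝ))

/-- `Θ_M(m)`, the optimal value of the original problem. -/
def thetaM {m n K l : ℕ} (D : Data m n K l) : EReal :=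
  ⨅ x ∈ D.X, ⨆ P ∈ D.DM, (D.cost x P : EReal)

/-- The optimal value of the inner approximation for a fixed `B`. -/
def thetaBar {m n K l : ℕ} (D : Data m n K l) {m₁ : ℕ} (B : Matrix (Fin m) (Fin m₁) ℝ) : EReal :=
  ⨅ x ∈ D.X, ⨆ P ∈ D.DU B, (D.cost x P : EReal)

/-- `Θ_U(m₁)`, the optimal value of the optimized inner approximation. -/
def thetaU {m n K l : ℕ} (D : Data m n K l) (m₁ : ℕ) : EReal :=
  ⨅ B ∈ orthoFrames m m₁, D.thetaBar B

/-- The corner entry `s - y_k⁰(x) - λ_kᵀ b - y_k(x)ᵀ μ + λ_kᵀ A μ`. -/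
def corner {m n K l : ℕ} (D : Data m n K l) (x : Fin n → ℝ) (s : ℝ) (lam : Fin K → Fin l → ℝ)
    (k : Fin K) : ℝ :=
  s - D.y₀ k x - lam k ⬝ᵥ D.b - D.y k x ⬝ᵥ D.μ + lam k ⬝ᵥ D.A.mulVec D.μ

/-- The vector `(U Λ^{1/2})ᵀ (Aᵀ λ_k - y_k(x))`. -/
def shift {m n K l : ℕ} (D : Data m n K l) (x : Fin n → ℝ) (lam : Fin K → Fin l → ℝ)
    (k : Fin K) : Fin m → ℝ :=
  D.L.transpose.mulVec (D.A.transpose.mulVec (lam k) - D.y k x)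

end Data

/-- A point `(x, s, λ̂, q, Q)` of the semidefinite program of the original problem. -/
structure MainPoint (m n K l : ℕ) where
  x : Fin n → ℝ
  s : ℝ
  lam : Fin K → Fin l → ℝ
  q : Fin m → ℝ
  Q : Matrix (Fin m) (Fin m) ℝ

/-- A point `(x, s, λ̂, q, Q_r, û)` of the semidefinite program of the inner approximation. -/
structure InnerPoint (m n K l m₁ : ℕ) where
  x : Fin n → ℝ
  s : ℝ
  lam : Fin K → Fin l → ℝ
  q : Fin m → ℝ
  Qr : Matrix (Fin m₁) (Fin m₁) ℝ
  u : Fin K → Fin m₁ → ℝ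

namespace Data

/-- The constraints of the semidefinite program of the original problem. -/
def MainFeasible {m n K l : ℕ} (D : Data m n K l) (z : MainPoint m n K l) : Prop :=
  z.x ∈ D.X ∧ (∀ k, 0 ≤ z.lam k) ∧
    ∀ k, (blockMatrix (D.corner z.x z.s z.lam k) (z.q + D.shift z.x z.lam k) z.Q).PosSemidef

/-- The objective `s + γ₂ I • Q + √γ₁ ‖q‖₂`. -/
def mainObj {m n K l : ℕ} (D : Data m n K l) (z : MainPoint m n K l) : ℝ :=
  z.s + D.γ₂ * z.Q.trace + √D.γ₁ * ‖WithLp.toLp 2 z.q‖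

/-- Optimal solutions of the semidefinite program of the original problem. -/
def MainOptimal {m n K l : ℕ} (D : Data m n K l) (z : MainPoint m n K l) : Prop :=
  D.MainFeasible z ∧ ∀ z', D.MainFeasible z' → D.mainObj z ≤ D.mainObj z'

/-- The constraints of the semidefinite program of the inner approximation with matrix `B`. -/
def InnerFeasible {m n K l : ℕ} (D : Data m n K l) {m₁ : ℕ} (B : Matrix (Fin m) (Fin m₁) ℝ)
    (z : InnerPoint m n K l m₁) : Prop :=
  z.x ∈ D.X ∧ (∀ k, 0 ≤ z.lam k) ∧
    (∀ k, (blockMatrix (D.corner z.x z.s z.lam k) (z.u k) z.Qr).PosSemidef) ∧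
    ∀ k, z.q + D.shift z.x z.lam k = B.mulVec (z.u k)

/-- The objective `s + γ₂ I • Q_r + √γ₁ ‖q‖₂`. -/
def innerObj {m n K l m₁ : ℕ} (D : Data m n K l) (z : InnerPoint m n K l m₁) : ℝ :=
  z.s + D.γ₂ * z.Qr.trace + √D.γ₁ * ‖WithLp.toLp 2 z.q‖

/-- The optimal value of the optimized inner approximation with the inner problem written as a
semidefinite program. -/
def thetaUSDP {m n K l : ℕ} (D : Data m n K l) (m₁ : ℕ) : EReal :=
  ⨅ B ∈ orthoFrames m m₁, ⨅ z : InnerPoint m n K l m₁, ⨅ _ : D.InnerFeasible B z,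
    (D.innerObj z : EReal)

/-- `(B, z)` is an optimal solution of the optimized inner approximation, minimized jointly over
the matrix `B` and the variables of the semidefinite program. -/
def InnerOptimal {m n K l : ℕ} (D : Data m n K l) {m₁ : ℕ} (B : Matrix (Fin m) (Fin m₁) ℝ)
    (z : InnerPoint m n K l m₁) : Prop :=
  B ∈ orthoFrames m m₁ ∧ D.InnerFeasible B z ∧
    ∀ B' ∈ orthoFrames m m₁, ∀ z', D.InnerFeasible B' z' → D.innerObj z ≤ D.innerObj z'

/-- The low-rank form of an optimal solution `z` of the semidefinite program of the original
problem: `V` has `K` orthonormal columns, `q = V δ`, `Q = V Y₁₁ Vᵀ` with `Y₁₁ ⪰ 0`, and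
`(U Λ^{1/2})ᵀ (Aᵀ λ_k - y_k(x)) = V ν_k` for all `k`. -/
def LowRankForm {m n K l : ℕ} (D : Data m n K l) (z : MainPoint m n K l)
    (V : Matrix (Fin m) (Fin K) ℝ) (δ : Fin K → ℝ) (Y₁₁ : Matrix (Fin K) (Fin K) ℝ)
    (ν : Fin K → Fin K → ℝ) : Prop :=
  D.MainOptimal z ∧ V ∈ orthoFrames m K ∧ z.q = V.mulVec δ ∧ Y₁₁.PosSemidef ∧
    z.Q = V * Y₁₁ * V.transpose ∧ ∀ k, D.shift z.x z.lam k = V.mulVec (ν k)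

end Data

end ODR

end

/-!
Three facts carry the proof: weak duality for the relaxed problem, strong duality for the original
problem, and a projection argument that compares the two semidefinite programs.

*Weak duality* (`Data.thetaBar_le_innerObj`). At a feasible point of the inner program, the cost is
bounded on the support by the quadratic function `s + qᵀξ + (Bᵀξ)ᵀ Q_r (Bᵀξ)`, whose expectation
under a distribution in `𝓓_U(B)` is at most the objective. Since `𝓓_M ⊆ 𝓓_U(B)`, this gives
`Θ_M ≤ Θ_U(m₁) ≤ thetaUSDP m₁`. No duality theorem for the relaxed problem is needed; this matters,
since its ambiguity set bounds second moments only along the range of `B` and is not compact.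

*Projection* (`Data.innerObj_compress_le`, `Data.mainObj_lift`). The `K` vectors `shift x λ̂ k` lie
in the range of some `B` with orthonormal columns once `K ≤ m₁ ≤ m`. Projecting `q` to this range
and replacing `Q` by `Bᵀ Q B` turns a feasible point of the original program into one of the inner
program without raising the objective. Conversely `Q = B Q_r Bᵀ` turns inner points into points of
the original program with the same objective. Hence both programs have the same value, and
projected optimal solutions are optimal.

*Strong duality* (`Data.exists_mainFeasible_of_forall_cost_lt`). For a fixed decision, the original
program is the conic dual of a problem over moments `(p_k, a_k, M_k)`, one triple for each piece of
the cost. Such a family is realized by a distribution with atoms `a_k / p_k`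
(`Data.exists_mem_DM`), so its value is at most the worst-case cost. The families of bounded trace
form a compact convex set, and Sion's minimax theorem, applied to the Lagrangian, produces a point
of the original program that violates its constraints by at most `ε I`; shifting `s` and `Q` by `ε`
and `ε I` repairs it at a cost that the bound on the trace was chosen to absorb. Compactness makes
a constraint qualification unnecessary, so that the case `γ₁ = 0` and that of an empty ambiguity
set are included.
-/

noncomputable section

namespace ODR

open Matrix

variable {m n K l : ℕ}

/-! ### Quadratic forms and orthonormal frames -/

lemma dotProduct_mulVec_symm {ι κ : Type*} [Fintype ι] [Fintype κ] (M : Matrix ι κ ℝ)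
    (v : ι → ℝ) (w : κ → ℝ) : v ⬝ᵥ M *ᵥ w = Mᵀ *ᵥ v ⬝ᵥ w := by
  rw [dotProduct_mulVec, mulVec_transpose]

lemma norm_toLp_sq {r : ℕ} (q : Fin r → ℝ) : ‖WithLp.toLp 2 q‖ ^ 2 = q ⬝ᵥ q := by
  rw [EuclideanSpace.norm_sq_eq]
  simp [dotProduct, sq]

lemma dotProduct_le_norm_mul {r : ℕ} (q a : Fin r → ℝ) :
    q ⬝ᵥ a ≤ ‖WithLp.toLp 2 q‖ * ‖WithLp.toLp 2 a‖ := by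
  have h := real_inner_le_norm (WithLp.toLp 2 a : EuclideanSpace ℝ (Fin r)) (WithLp.toLp 2 q)
  simpa [EuclideanSpace.inner_eq_star_dotProduct, mul_comm] using h

/-- The block matrix `[[a, ½ wᵀ], [½ w, Q]]` is positive semidefinite exactly when its quadratic
form `a t² + t wᵀv + vᵀ Q v` is nonnegative. -/
lemma blockMatrix_posSemidef_iff {r : ℕ} (a : ℝ) (w : Fin r → ℝ) (Q : Matrix (Fin r) (Fin r) ℝ) :
    (blockMatrix a w Q).PosSemidef ↔
      Q.IsHermitian ∧ ∀ (t : ℝ) (v : Fin r → ℝ), 0 ≤ a * t ^ 2 + t * (w ⬝ᵥ v) + v ⬝ᵥ Q *ᵥ v := by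
  rw [posSemidef_iff_dotProduct_mulVec]
  have key (t : ℝ) (v : Fin r → ℝ) :
      (Sum.elim (fun _ => t) v : Unit ⊕ Fin r → ℝ) ⬝ᵥ
        blockMatrix a w Q *ᵥ (Sum.elim (fun _ => t) v) =
      a * t ^ 2 + t * (w ⬝ᵥ v) + v ⬝ᵥ Q *ᵥ v := by
    have h1 : (replicateCol Unit ((1 / 2 : ℝ) • w)) *ᵥ (fun _ : Unit => t) = (t / 2) • w := by
      ext i; simp [mulVec, dotProduct]; ring
    have h2 : (replicateRow Unit ((1 / 2 : ℝ) • w)) *ᵥ v = fun _ => (1 / 2) * (w ⬝ᵥ v) := by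
      ext i; simp [mulVec, replicateRow, dotProduct, Finset.mul_sum, mul_assoc]
    have h3 : (Matrix.of fun _ _ : Unit => a) *ᵥ (fun _ : Unit => t) = fun _ => a * t := by
      ext i; simp [mulVec, dotProduct]
    have h4 (c d : ℝ) : (fun _ : Unit => c) ⬝ᵥ (fun _ => d) = c * d := by simp [dotProduct]
    rw [blockMatrix, fromBlocks_mulVec, Sum.elim_comp_inl, Sum.elim_comp_inr, h1, h2, h3,
      sumElim_dotProduct_sumElim, dotProduct_add v, dotProduct_smul, dotProduct_comm v w, dotProduct_add, h4, h4,
      smul_eq_mul]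
    ring
  constructor
  · rintro ⟨h1, h2⟩
    refine ⟨?_, fun t v => ?_⟩
    · ext i j
      exact congrFun (congrFun h1 (Sum.inr i)) (Sum.inr j)
    · rw [← key]
      simpa using h2 (Sum.elim (fun _ => t) v)
  · rintro ⟨h1, h2⟩
    refine ⟨?_, fun z => ?_⟩
    · rw [blockMatrix, Matrix.IsHermitian, fromBlocks_conjTranspose, h1.eq]
      congr 1
    · have hz : z = Sum.elim (fun _ => z (Sum.inl ())) (z ∘ Sum.inr) := by
        ext i; rcases i with i | i <;> rfl
      rw [hz]
      simpa [key] using h2 (z (Sum.inl ())) (z ∘ Sum.inr)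

lemma posSemidef_of_blockMatrix {r : ℕ} {a : ℝ} {w : Fin r → ℝ} {Q : Matrix (Fin r) (Fin r) ℝ}
    (h : (blockMatrix a w Q).PosSemidef) : Q.PosSemidef := by
  rw [blockMatrix_posSemidef_iff] at h
  exact posSemidef_iff_dotProduct_mulVec.2 ⟨h.1, fun v => by simpa using h.2 0 v⟩

/-- Positive semidefiniteness of the block matrix is stable under congruence by `diag(1, C)`. -/
lemma blockMatrix_congr {r p : ℕ} {a : ℝ} {w : Fin r → ℝ} {Q : Matrix (Fin r) (Fin r) ℝ}
    (h : (blockMatrix a w Q).PosSemidef) (C : Matrix (Fin r) (Fin p) ℝ) :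
    (blockMatrix a (Cᵀ *ᵥ w) (Cᵀ * Q * C)).PosSemidef := by
  rw [blockMatrix_posSemidef_iff] at h ⊢
  refine ⟨by simpa using isHermitian_conjTranspose_mul_mul C h.1, fun t v => ?_⟩
  have := h.2 t (C *ᵥ v)
  rw [dotProduct_mulVec_symm] at this
  rw [← mulVec_mulVec, ← mulVec_mulVec, dotProduct_mulVec_symm Cᵀ, transpose_transpose]
  exact this

open scoped MatrixOrder in
lemma trace_mul_nonneg {r : ℕ} {Q N : Matrix (Fin r) (Fin r) ℝ} (hQ : Q.PosSemidef)
    (hN : N.PosSemidef) : 0 ≤ (Q * N).trace := by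
  obtain ⟨C, rfl⟩ := CStarAlgebra.nonneg_iff_eq_star_mul_self.1 (nonneg_iff_posSemidef.2 hQ)
  rw [Matrix.mul_assoc, trace_mul_comm]
  exact (hN.mul_mul_conjTranspose_same C).trace_nonneg

/-- Compressing a positive semidefinite matrix to the range of a frame does not increase its
trace: with `P = 1 - B Bᵀ`, the difference is `tr (P Q P) ≥ 0`. -/
lemma trace_compress_le {m r : ℕ} {B : Matrix (Fin m) (Fin r) ℝ} (hB : B ∈ orthoFrames m r)
    {Q : Matrix (Fin m) (Fin m) ℝ} (hQ : Q.PosSemidef) : (Bᵀ * Q * B).trace ≤ Q.trace := by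
  have hB' : Bᵀ * B = 1 := hB
  have h1 := (hQ.conjTranspose_mul_mul_same (1 - B * Bᵀ)).trace_nonneg
  have h2 : (1 - B * Bᵀ) * (1 - B * Bᵀ)ᴴ = 1 - B * Bᵀ := by
    have : B * Bᵀ * (B * Bᵀ) = B * Bᵀ := by
      rw [Matrix.mul_assoc, ← Matrix.mul_assoc Bᵀ, hB', Matrix.one_mul]
    simp [Matrix.mul_sub, Matrix.sub_mul, this]
  rw [Matrix.mul_assoc, trace_mul_comm, Matrix.mul_assoc, h2, Matrix.mul_sub, trace_sub,
    Matrix.mul_one, ← Matrix.mul_assoc] at h1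
  rw [Matrix.mul_assoc, trace_mul_comm]
  linarith

lemma norm_project_le {m r : ℕ} {B : Matrix (Fin m) (Fin r) ℝ} (hB : B ∈ orthoFrames m r)
    (q : Fin m → ℝ) : ‖WithLp.toLp 2 (B *ᵥ (Bᵀ *ᵥ q))‖ ≤ ‖WithLp.toLp 2 q‖ := by
  have hB' : Bᵀ * B = 1 := hB
  refine le_of_sq_le_sq ?_ (norm_nonneg _)
  rw [norm_toLp_sq, norm_toLp_sq]
  set u := Bᵀ *ᵥ q with hu
  have h1 : B *ᵥ u ⬝ᵥ B *ᵥ u = u ⬝ᵥ u := by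
    rw [dotProduct_mulVec_symm, mulVec_mulVec, hB', one_mulVec]
  have h2 : q ⬝ᵥ B *ᵥ u = u ⬝ᵥ u := by rw [dotProduct_mulVec_symm]
  have h3 : 0 ≤ (q - B *ᵥ u) ⬝ᵥ (q - B *ᵥ u) := by
    rw [← norm_toLp_sq]; positivity
  rw [sub_dotProduct, dotProduct_sub, dotProduct_sub, dotProduct_comm (B *ᵥ u) q, h1, h2] at h3
  linarith

/-- Any `K ≤ r ≤ m` vectors of `ℝᵐ` lie in the range of some `m × r` matrix with orthonormal
columns: the first `r` vectors of a Gram-Schmidt basis. -/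
lemma exists_orthoFrame {m K r : ℕ} (hKr : K ≤ r) (hrm : r ≤ m) (c : Fin K → Fin m → ℝ) :
    ∃ B ∈ orthoFrames m r, ∀ k, B *ᵥ (Bᵀ *ᵥ c k) = c k := by
  let f : Fin m → EuclideanSpace ℝ (Fin m) := fun i =>
    if h : (i : ℕ) < K then WithLp.toLp 2 (c ⟨i, h⟩) else 0
  let b := InnerProductSpace.gramSchmidtOrthonormalBasis (𝕜 := ℝ) (by simp) f
  refine ⟨Matrix.of fun i j => (b (Fin.castLE hrm j)).ofLp i, ?_, fun k => ?_⟩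
  · change _ * _ = _
    ext i j
    have := orthonormal_iff_ite.1 b.orthonormal (Fin.castLE hrm i) (Fin.castLE hrm j)
    rw [EuclideanSpace.inner_eq_star_dotProduct, dotProduct_comm] at this
    simpa [Matrix.mul_apply, dotProduct, Matrix.one_apply] using this
  · let i₀ : Fin m := Fin.castLE (hKr.trans hrm) k
    have hf : f i₀ = WithLp.toLp 2 (c k) := by simp [f, i₀]
    have h0 (j : Fin m) (hj : r ≤ j) : inner ℝ (b j) (f i₀) = 0 := by
      refine InnerProductSpace.gramSchmidtOrthonormalBasis_inv_triangular _ _ ?_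
      exact Fin.lt_def.2 (lt_of_lt_of_le k.2 (hKr.trans hj))
    have h1 := b.sum_repr' (f i₀)
    have h2 : ∑ j, inner ℝ (b j) (f i₀) • b j =
        ∑ j : Fin r, inner ℝ (b (Fin.castLE hrm j)) (f i₀) • b (Fin.castLE hrm j) := by
      symm
      refine Finset.sum_of_injOn (Fin.castLE hrm) (Fin.castLE_injective hrm).injOn
        (by simp) (fun j _ hj => ?_) (fun _ _ => rfl)
      rw [h0 j, zero_smul]
      by_contra! hlt
      exact hj ⟨⟨j, hlt⟩, by simp, rfl⟩
    rw [h2, hf] at h1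
    ext i
    have h3 := congrArg (fun z : EuclideanSpace ℝ (Fin m) => z.ofLp i) h1
    simp only [WithLp.ofLp_sum, WithLp.ofLp_smul, Finset.sum_apply, Pi.smul_apply,
      EuclideanSpace.inner_eq_star_dotProduct, smul_eq_mul] at h3
    rw [← h3]
    simp [mulVec, dotProduct, mul_comm]

/-! ### Passing between the two semidefinite programs -/

/-- The restriction of a point of the original program to the range of `B`: `q` is projected to
the range and `Q` is compressed to `Bᵀ Q B`. -/
def Data.compress (D : Data m n K l) {r : ℕ} (B : Matrix (Fin m) (Fin r) ℝ)
    (z : MainPoint m n K l) : InnerPoint m n K l r :=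
  ⟨z.x, z.s, z.lam, B *ᵥ (Bᵀ *ᵥ z.q), Bᵀ * z.Q * B,
    fun k => Bᵀ *ᵥ (z.q + D.shift z.x z.lam k)⟩

/-- The point of the original program with `Q = B Q_r Bᵀ`. -/
def InnerPoint.lift {r : ℕ} (w : InnerPoint m n K l r) (B : Matrix (Fin m) (Fin r) ℝ) :
    MainPoint m n K l :=
  ⟨w.x, w.s, w.lam, w.q, B * w.Qr * Bᵀ⟩

lemma Data.innerFeasible_compress (D : Data m n K l) {r : ℕ} {B : Matrix (Fin m) (Fin r) ℝ}
    {z : MainPoint m n K l} (hz : D.MainFeasible z)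
    (hc : ∀ k, B *ᵥ (Bᵀ *ᵥ D.shift z.x z.lam k) = D.shift z.x z.lam k) :
    D.InnerFeasible B (D.compress B z) := by
  refine ⟨hz.1, hz.2.1, fun k => blockMatrix_congr (hz.2.2 k) B, fun k => ?_⟩
  simp only [compress, mulVec_add, hc]

lemma Data.innerObj_compress_le (D : Data m n K l) (hK : 1 ≤ K) (hγ₂ : 0 ≤ D.γ₂) {r : ℕ}
    {B : Matrix (Fin m) (Fin r) ℝ} (hB : B ∈ orthoFrames m r) {z : MainPoint m n K l}
    (hz : D.MainFeasible z) : D.innerObj (D.compress B z) ≤ D.mainObj z := by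
  have h1 := trace_compress_le hB (posSemidef_of_blockMatrix (hz.2.2 ⟨0, hK⟩))
  have h2 := norm_project_le hB z.q
  simp only [innerObj, mainObj, compress]
  gcongr

lemma Data.mainFeasible_lift (D : Data m n K l) {r : ℕ} {B : Matrix (Fin m) (Fin r) ℝ}
    {w : InnerPoint m n K l r} (hw : D.InnerFeasible B w) : D.MainFeasible (w.lift B) := by
  refine ⟨hw.1, hw.2.1, fun k => ?_⟩
  have := blockMatrix_congr (hw.2.2.1 k) Bᵀ
  rwa [transpose_transpose, ← hw.2.2.2 k] at this

lemma Data.mainObj_lift (D : Data m n K l) {r : ℕ} {B : Matrix (Fin m) (Fin r) ℝ}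
    (hB : B ∈ orthoFrames m r) (w : InnerPoint m n K l r) :
    D.mainObj (w.lift B) = D.innerObj w := by
  have hB' : Bᵀ * B = 1 := hB
  simp only [mainObj, innerObj, InnerPoint.lift]
  rw [trace_mul_comm, ← Matrix.mul_assoc, hB', Matrix.one_mul]

/-! ### Weak duality -/

lemma integrable_dotProduct {P : Measure (Fin m → ℝ)} (h : ∀ i, Integrable (fun ξ => ξ i) P)
    (c : Fin m → ℝ) : Integrable (fun ξ => c ⬝ᵥ ξ) P :=
  integrable_finsetSum _ fun i _ => (h i).const_mul (c i)

lemma integral_dotProduct {P : Measure (Fin m → ℝ)} (h : ∀ i, Integrable (fun ξ => ξ i) P)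
    (c : Fin m → ℝ) : ∫ ξ, c ⬝ᵥ ξ ∂P = c ⬝ᵥ meanVec P := by
  simp only [dotProduct, meanVec]
  rw [integral_finsetSum _ fun i _ => (h i).const_mul (c i)]
  simp only [integral_const_mul]

section Quadratic

variable {r : ℕ} {P : Measure (Fin m → ℝ)} {g : (Fin m → ℝ) → Fin r → ℝ}

lemma dotProduct_mulVec_eq_sum (Q : Matrix (Fin r) (Fin r) ℝ) (v : Fin r → ℝ) :
    v ⬝ᵥ Q *ᵥ v = ∑ i, ∑ j, Q i j * (v j * v i) := by
  simp only [dotProduct, mulVec, Finset.mul_sum]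
  exact Finset.sum_congr rfl fun i _ => Finset.sum_congr rfl fun j _ => by ring

lemma integrable_quadratic (h : ∀ i j, Integrable (fun ξ => g ξ i * g ξ j) P)
    (Q : Matrix (Fin r) (Fin r) ℝ) : Integrable (fun ξ => g ξ ⬝ᵥ Q *ᵥ g ξ) P := by
  simp only [dotProduct_mulVec_eq_sum]
  exact integrable_finsetSum _ fun i _ => integrable_finsetSum _ fun j _ => (h j i).const_mul _

lemma integral_quadratic (h : ∀ i j, Integrable (fun ξ => g ξ i * g ξ j) P)
    (Q : Matrix (Fin r) (Fin r) ℝ) :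
    ∫ ξ, g ξ ⬝ᵥ Q *ᵥ g ξ ∂P = (Q * secondMoment P g).trace := by
  have hi (i j : Fin r) : Integrable (fun ξ => Q i j * (g ξ j * g ξ i)) P := (h j i).const_mul _
  simp only [dotProduct_mulVec_eq_sum]
  rw [integral_finsetSum _ fun i _ => integrable_finsetSum _ fun j _ => hi i j]
  simp only [trace, diag, mul_apply, secondMoment, of_apply]
  refine Finset.sum_congr rfl fun i _ => ?_
  rw [integral_finsetSum _ fun j _ => hi i j]
  simp only [integral_const_mul]

end Quadratic

namespace Data

variable (D : Data m n K l)

/-- In the coordinates `ξ ↦ L ξ + μ`, the piece `k` of the cost is affine in `ξ`. -/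
lemma piece_eq (x : Fin n → ℝ) (k : Fin K) (ξ : Fin m → ℝ) :
    D.y₀ k x + D.y k x ⬝ᵥ (D.L *ᵥ ξ + D.μ) =
      (D.y₀ k x + D.y k x ⬝ᵥ D.μ) + (D.Lᵀ *ᵥ D.y k x) ⬝ᵥ ξ := by
  rw [dotProduct_add, dotProduct_mulVec_symm]
  ring

lemma integrable_f (hK : 1 ≤ K) {P : Measure (Fin m → ℝ)} [IsProbabilityMeasure P]
    (h : ∀ i, Integrable (fun ξ => ξ i) P) (x : Fin n → ℝ) :
    Integrable (fun ξ => D.f x (D.L *ᵥ ξ + D.μ)) P := by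
  have : Nonempty (Fin K) := ⟨⟨0, hK⟩⟩
  have hp (k : Fin K) : Integrable (fun ξ => D.y₀ k x + D.y k x ⬝ᵥ (D.L *ᵥ ξ + D.μ)) P := by
    simp only [piece_eq]
    exact (integrable_const _).add (integrable_dotProduct h _)
  have hs := Finset.sup'_induction (p := fun φ : (Fin m → ℝ) → ℝ => Integrable φ P)
    Finset.univ_nonempty (fun (k : Fin K) ξ => D.y₀ k x + D.y k x ⬝ᵥ (D.L *ᵥ ξ + D.μ))
    (fun _ h₁ _ h₂ => h₁.sup h₂) fun k _ => hp k
  convert hs using 1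
  ext ξ
  rw [Finset.sup'_apply, Finset.sup'_univ_eq_ciSup]
  rfl

lemma le_f (x : Fin n → ℝ) (ζ : Fin m → ℝ) (k : Fin K) :
    D.y₀ k x + D.y k x ⬝ᵥ ζ ≤ D.f x ζ :=
  le_ciSup (f := fun k => D.y₀ k x + D.y k x ⬝ᵥ ζ) (Set.finite_range _).bddAbove k

/-- The constraint with index `k` bounds the piece `k` on the support by the quadratic function
`s + qᵀξ + (Bᵀξ)ᵀ Q_r (Bᵀξ)`: evaluate the quadratic form of the block matrix at `(1, Bᵀξ)`. -/
lemma f_le_quadratic (hK : 1 ≤ K) {r : ℕ} {B : Matrix (Fin m) (Fin r) ℝ}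
    {w : InnerPoint m n K l r} (hw : D.InnerFeasible B w) {ξ : Fin m → ℝ} (hξ : ξ ∈ D.SI) :
    D.f w.x (D.L *ᵥ ξ + D.μ) ≤ w.s + w.q ⬝ᵥ ξ + (Bᵀ *ᵥ ξ) ⬝ᵥ w.Qr *ᵥ (Bᵀ *ᵥ ξ) := by
  have : Nonempty (Fin K) := ⟨⟨0, hK⟩⟩
  refine ciSup_le fun k => ?_
  have h1 := ((blockMatrix_posSemidef_iff _ _ _).1 (hw.2.2.1 k)).2 1 (Bᵀ *ᵥ ξ)
  have h2 : w.u k ⬝ᵥ Bᵀ *ᵥ ξ = (w.q + D.shift w.x w.lam k) ⬝ᵥ ξ := by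
    rw [dotProduct_mulVec_symm, transpose_transpose, hw.2.2.2 k]
  have h3 : w.lam k ⬝ᵥ D.A *ᵥ (D.L *ᵥ ξ + D.μ) ≤ w.lam k ⬝ᵥ D.b :=
    dotProduct_le_dotProduct_of_nonneg_left hξ (hw.2.1 k)
  have h4 : D.shift w.x w.lam k ⬝ᵥ ξ =
      w.lam k ⬝ᵥ D.A *ᵥ (D.L *ᵥ ξ) - D.y k w.x ⬝ᵥ D.L *ᵥ ξ := by
    rw [shift, ← dotProduct_mulVec_symm, sub_dotProduct, ← dotProduct_mulVec_symm]
  rw [h2, add_dotProduct, h4, corner] at h1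
  rw [mulVec_add, dotProduct_add] at h3
  rw [dotProduct_add]
  linarith

lemma cost_le_innerObj (hK : 1 ≤ K) {r : ℕ} {B : Matrix (Fin m) (Fin r) ℝ}
    {w : InnerPoint m n K l r} (hw : D.InnerFeasible B w)
    {P : ProbabilityMeasure (Fin m → ℝ)} (hP : P ∈ D.DU B) :
    D.cost w.x P ≤ D.innerObj w := by
  obtain ⟨hsupp, hint, hmean, hint₂, hcov⟩ := hP
  have hQ := posSemidef_of_blockMatrix (hw.2.2.1 ⟨0, hK⟩)
  have hi₁ : Integrable (fun ξ => w.s + w.q ⬝ᵥ ξ) (P : Measure (Fin m → ℝ)) :=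
    (integrable_const w.s).add (integrable_dotProduct hint w.q)
  have hi₂ := integrable_quadratic hint₂ w.Qr
  have h1 : D.cost w.x P ≤ ∫ ξ, (w.s + w.q ⬝ᵥ ξ) + (Bᵀ *ᵥ ξ) ⬝ᵥ w.Qr *ᵥ (Bᵀ *ᵥ ξ)
      ∂(P : Measure (Fin m → ℝ)) := by
    refine integral_mono_ae (D.integrable_f hK hint w.x) (hi₁.add hi₂) ?_
    filter_upwards [hsupp] with ξ hξ using D.f_le_quadratic hK hw hξ
  have h2 : ∫ ξ, (w.s + w.q ⬝ᵥ ξ) + (Bᵀ *ᵥ ξ) ⬝ᵥ w.Qr *ᵥ (Bᵀ *ᵥ ξ)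
      ∂(P : Measure (Fin m → ℝ)) = w.s + w.q ⬝ᵥ meanVec (P : Measure (Fin m → ℝ)) +
        (w.Qr * secondMoment (P : Measure (Fin m → ℝ)) (fun ξ => Bᵀ *ᵥ ξ)).trace := by
    rw [integral_add hi₁ hi₂, integral_add (integrable_const _) (integrable_dotProduct hint _),
      integral_quadratic hint₂, integral_dotProduct hint]
    simp
  have h3 : w.q ⬝ᵥ meanVec (P : Measure (Fin m → ℝ)) ≤ √D.γ₁ * ‖WithLp.toLp 2 w.q‖ := by
    refine (dotProduct_le_norm_mul _ _).trans ?_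
    rw [mul_comm]
    gcongr
    refine Real.le_sqrt_of_sq_le ?_
    rwa [norm_toLp_sq]
  have h4 := trace_mul_nonneg hQ hcov
  rw [Matrix.mul_sub, Matrix.mul_smul, Matrix.mul_one, trace_sub, trace_smul, smul_eq_mul] at h4
  rw [innerObj]
  linarith

lemma thetaBar_le_innerObj (hK : 1 ≤ K) {r : ℕ} {B : Matrix (Fin m) (Fin r) ℝ}
    {w : InnerPoint m n K l r} (hw : D.InnerFeasible B w) :
    D.thetaBar B ≤ (D.innerObj w : EReal) :=
  (iInf₂_le w.x hw.1).trans <| iSup₂_le fun _ hP =>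
    EReal.coe_le_coe_iff.2 (D.cost_le_innerObj hK hw hP)

/-- The relaxation enlarges the ambiguity set. -/
lemma DM_subset_DU {r : ℕ} {B : Matrix (Fin m) (Fin r) ℝ} (hB : B ∈ orthoFrames m r) :
    D.DM ⊆ D.DU B := by
  have hB' : Bᵀ * B = 1 := hB
  rintro P ⟨h1, h2, h3, h4, h5⟩
  have hBi (i j : Fin r) (ξ : Fin m → ℝ) : (Bᵀ *ᵥ ξ) i * (Bᵀ *ᵥ ξ) j =
      ∑ a, ∑ b, Bᵀ i a * B b j * (ξ a * ξ b) := by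
    simp only [mulVec, dotProduct, Finset.sum_mul_sum, transpose_apply]
    exact Finset.sum_congr rfl fun a _ => Finset.sum_congr rfl fun b _ => by ring
  have hi (i j : Fin r) (a b : Fin m) :
      Integrable (fun ξ : Fin m → ℝ => Bᵀ i a * B b j * (ξ a * ξ b)) (P : Measure (Fin m → ℝ)) :=
    (h4 a b).const_mul _
  refine ⟨h1, h2, h3, fun i j => ?_, ?_⟩
  · simp only [hBi]
    exact integrable_finsetSum _ fun a _ => integrable_finsetSum _ fun b _ => hi i j a b
  · have hM : secondMoment (P : Measure (Fin m → ℝ)) (fun ξ => Bᵀ *ᵥ ξ) =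
        Bᵀ * secondMoment (P : Measure (Fin m → ℝ)) (fun ξ => ξ) * B := by
      ext i j
      simp only [secondMoment, of_apply, hBi]
      rw [integral_finsetSum _ fun a _ => integrable_finsetSum _ fun b _ => hi i j a b]
      simp only [Matrix.mul_apply, Finset.sum_mul, of_apply]
      rw [Finset.sum_comm]
      refine Finset.sum_congr rfl fun a _ => ?_
      rw [integral_finsetSum _ fun b _ => hi i j a b]
      refine Finset.sum_congr rfl fun b _ => ?_
      rw [integral_const_mul]
      ring
    have := h5.conjTranspose_mul_mul_same B
    rw [conjTranspose_eq_transpose_of_trivial, Matrix.mul_sub, Matrix.sub_mul, Matrix.mul_smul,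
      Matrix.mul_one, Matrix.smul_mul, hB', ← hM] at this
    exact this

lemma thetaM_le_thetaBar {r : ℕ} {B : Matrix (Fin m) (Fin r) ℝ} (hB : B ∈ orthoFrames m r) :
    D.thetaM ≤ D.thetaBar B :=
  iInf₂_mono fun _ _ => biSup_mono fun _ hP => D.DM_subset_DU hB hP

end Data

/-! ### The moment cone -/

/-- Triples `(p, a, M)` for which `[[p, aᵀ], [a, M]]` is positive semidefinite: the possible mass,
first moment and (a bound for the) second moment of a finite measure on `ℝᵐ`. -/
def momentCone (m : ℕ) : Set (ℝ × (Fin m → ℝ) × Matrix (Fin m) (Fin m) ℝ) :=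
  {z | z.2.2.IsHermitian ∧
    ∀ (t : ℝ) (v : Fin m → ℝ), 0 ≤ z.1 * t ^ 2 + 2 * t * (z.2.1 ⬝ᵥ v) + v ⬝ᵥ z.2.2 *ᵥ v}

lemma convex_momentCone : Convex ℝ (momentCone m) := by
  rintro z ⟨h1, h2⟩ z' ⟨h1', h2'⟩ α β hα hβ -
  refine ⟨?_, fun t v => ?_⟩
  · have h3 : IsSelfAdjoint z.2.2 := h1
    have h4 : IsSelfAdjoint z'.2.2 := h1'
    exact ((IsSelfAdjoint.all α).smul h3).add ((IsSelfAdjoint.all β).smul h4)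
  · have := add_nonneg (mul_nonneg hα (h2 t v)) (mul_nonneg hβ (h2' t v))
    simp only [Prod.fst_add, Prod.snd_add, Prod.smul_fst, Prod.smul_snd, add_dotProduct,
      smul_dotProduct, add_mulVec, smul_mulVec, dotProduct_add, dotProduct_smul, smul_eq_mul]
    linarith

lemma isClosed_momentCone : IsClosed (momentCone m) := by
  have h : momentCone m = {z | z.2.2ᴴ = z.2.2} ∩ ⋂ (t : ℝ) (v : Fin m → ℝ),
      {z | 0 ≤ z.1 * t ^ 2 + 2 * t * (z.2.1 ⬝ᵥ v) + v ⬝ᵥ z.2.2 *ᵥ v} := by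
    ext z
    simp [momentCone, Matrix.IsHermitian]
  rw [h]
  exact (isClosed_eq (by fun_prop) (by fun_prop)).inter <|
    isClosed_iInter fun t => isClosed_iInter fun v => isClosed_le continuous_const (by fun_prop)

lemma rankOne_mem_momentCone {c : ℝ} (hc : 0 ≤ c) (t : ℝ) (v : Fin m → ℝ) :
    (c * t ^ 2, (c * t) • v, c • vecMulVec v v) ∈ momentCone m := by
  refine ⟨?_, fun t' v' => ?_⟩
  · ext i j
    simp [vecMulVec_apply, mul_comm]
  · have h : v' ⬝ᵥ (c • vecMulVec v v) *ᵥ v' = c * (v ⬝ᵥ v') ^ 2 := by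
      rw [smul_mulVec, vecMulVec_mulVec, dotProduct_smul, op_smul_eq_smul, dotProduct_smul,
        dotProduct_comm v' v, smul_eq_mul, smul_eq_mul]
      ring
    rw [h, smul_dotProduct, smul_eq_mul]
    have : 0 ≤ c * (t * t' + v ⬝ᵥ v') ^ 2 := by positivity
    linarith

section Bounds

variable {z : ℝ × (Fin m → ℝ) × Matrix (Fin m) (Fin m) ℝ} (hz : z ∈ momentCone m)
include hz

lemma momentCone_mass_nonneg : 0 ≤ z.1 := by simpa using hz.2 1 0

lemma momentCone_posSemidef : z.2.2.PosSemidef :=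
  posSemidef_iff_dotProduct_mulVec.2 ⟨hz.1, fun v => by simpa using hz.2 0 v⟩

lemma momentCone_diag_le (i : Fin m) : z.2.2 i i ≤ z.2.2.trace :=
  Finset.single_le_sum (f := fun i => z.2.2 i i)
    (fun _ _ => (momentCone_posSemidef hz).diag_nonneg) (Finset.mem_univ i)

lemma momentCone_abs_mean_le (i : Fin m) : |z.2.1 i| ≤ z.1 + z.2.2.trace := by
  have h1 := hz.2 1 (Pi.single i 1)
  have h2 := hz.2 (-1) (Pi.single i 1)
  have h3 := momentCone_diag_le hz i
  have h4 := momentCone_mass_nonneg hz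
  have h5 := (momentCone_posSemidef hz).trace_nonneg
  simp only [dotProduct_single_one, single_one_dotProduct, mulVec_single_one, col_apply] at h1 h2
  rw [abs_le]
  constructor <;> linarith

lemma momentCone_abs_moment_le (i j : Fin m) : |z.2.2 i j| ≤ z.1 + z.2.2.trace := by
  have h1 := hz.2 0 (Pi.single i 1 + Pi.single j 1)
  have h2 := hz.2 0 (Pi.single i 1 - Pi.single j 1)
  have h3 := momentCone_diag_le hz i
  have h3' := momentCone_diag_le hz j
  have h4 := momentCone_mass_nonneg hz
  have h5 := (momentCone_posSemidef hz).trace_nonneg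
  have h6 : z.2.2 j i = z.2.2 i j := by simpa using hz.1.apply i j
  simp only [mulVec_add, mulVec_sub, add_dotProduct, sub_dotProduct, dotProduct_add,
    dotProduct_sub, single_one_dotProduct, mulVec_single_one, col_apply, h6] at h1 h2
  rw [abs_le]
  constructor <;> linarith

/-- Nonnegativity of the Schur complement `M - a aᵀ / p`. For `p = 0` the convention `0⁻¹ = 0`
reduces it to `M ⪰ 0`. -/
lemma momentCone_schur (v : Fin m → ℝ) : z.1⁻¹ * (z.2.1 ⬝ᵥ v) ^ 2 ≤ v ⬝ᵥ z.2.2 *ᵥ v := by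
  have h := hz.2 (-(z.1⁻¹ * (z.2.1 ⬝ᵥ v))) v
  rcases eq_or_ne z.1 0 with h0 | h0
  · simpa [h0] using h
  · have : z.1 * (-(z.1⁻¹ * (z.2.1 ⬝ᵥ v))) ^ 2 = z.1⁻¹ * (z.2.1 ⬝ᵥ v) ^ 2 := by
      field_simp
    rw [this] at h
    linarith

lemma momentCone_mean_eq_zero (h0 : z.1 = 0) : z.2.1 = 0 := by
  rw [← dotProduct_self_eq_zero]
  by_contra hne
  -- Otherwise the quadratic form, affine in `t`, takes negative values.
  have h := hz.2 (-(z.2.1 ⬝ᵥ z.2.2 *ᵥ z.2.1 + 1) / (2 * (z.2.1 ⬝ᵥ z.2.1))) z.2.1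
  have : 2 * (-(z.2.1 ⬝ᵥ z.2.2 *ᵥ z.2.1 + 1) / (2 * (z.2.1 ⬝ᵥ z.2.1))) * (z.2.1 ⬝ᵥ z.2.1) =
      -(z.2.1 ⬝ᵥ z.2.2 *ᵥ z.2.1 + 1) := by
    field_simp
  rw [this, h0] at h
  linarith

end Bounds

/-- Families of `K` elements of the moment cone of total trace at most `R`. -/
def momentFamilies (m K : ℕ) (R : ℝ) : Set (Fin K → ℝ × (Fin m → ℝ) × Matrix (Fin m) (Fin m) ℝ) :=
  {Z | (∀ k, Z k ∈ momentCone m) ∧ ∑ k, ((Z k).1 + (Z k).2.2.trace) ≤ R}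

lemma convex_momentFamilies (R : ℝ) : Convex ℝ (momentFamilies m K R) := by
  rintro Z ⟨h1, h2⟩ Z' ⟨h1', h2'⟩ α β hα hβ hαβ
  refine ⟨fun k => convex_momentCone (h1 k) (h1' k) hα hβ hαβ, ?_⟩
  have h3 : ∑ k, (((α • Z + β • Z') k).1 + ((α • Z + β • Z') k).2.2.trace) =
      α * ∑ k, ((Z k).1 + (Z k).2.2.trace) + β * ∑ k, ((Z' k).1 + (Z' k).2.2.trace) := by
    rw [Finset.mul_sum, Finset.mul_sum, ← Finset.sum_add_distrib]
    refine Finset.sum_congr rfl fun k _ => ?_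
    simp only [Pi.add_apply, Pi.smul_apply, Prod.fst_add, Prod.snd_add, Prod.smul_fst,
      Prod.smul_snd, trace_add, trace_smul, smul_eq_mul]
    ring
  rw [h3]
  calc _ ≤ α * R + β * R := by gcongr
    _ = R := by rw [← add_mul, hαβ, one_mul]

lemma isCompact_momentFamilies (R : ℝ) : IsCompact (momentFamilies m K R) := by
  have hc : IsCompact (Set.pi Set.univ fun _ : Fin K => Set.Icc (-R) R ×ˢ
      (Set.pi Set.univ fun _ : Fin m => Set.Icc (-R) R) ×ˢ
      (Set.pi Set.univ fun _ : Fin m => Set.pi Set.univ fun _ : Fin m => Set.Icc (-R) R)) :=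
    isCompact_univ_pi fun _ => isCompact_Icc.prod <|
      (isCompact_univ_pi fun _ => isCompact_Icc).prod <|
        isCompact_univ_pi fun _ => isCompact_univ_pi fun _ => isCompact_Icc
  refine IsCompact.of_isClosed_subset hc ?_ ?_
  · have h : momentFamilies m K R = (⋂ k, {Z | Z k ∈ momentCone m}) ∩
        {Z | ∑ k, ((Z k).1 + (Z k).2.2.trace) ≤ R} := by
      ext Z
      simp [momentFamilies]
    rw [h]
    exact (isClosed_iInter fun k => isClosed_momentCone.preimage (continuous_apply k)).inter
      (isClosed_le (by fun_prop) continuous_const)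
  · rintro Z ⟨h1, h2⟩ k -
    have h3 : (Z k).1 + (Z k).2.2.trace ≤ R := by
      refine (Finset.single_le_sum (f := fun k => (Z k).1 + (Z k).2.2.trace)
        (fun k _ => ?_) (Finset.mem_univ k)).trans h2
      exact add_nonneg (momentCone_mass_nonneg (h1 k)) (momentCone_posSemidef (h1 k)).trace_nonneg
    have h4 := momentCone_mass_nonneg (h1 k)
    have h5 := (momentCone_posSemidef (h1 k)).trace_nonneg
    refine ⟨⟨by linarith, by linarith⟩, fun i _ => ?_, fun i _ j _ => ?_⟩
    · exact abs_le.1 ((momentCone_abs_mean_le (h1 k) i).trans h3)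
    · exact abs_le.1 ((momentCone_abs_moment_le (h1 k) i j).trans h3)

/-! ### Finitely supported distributions from families of moments -/

namespace Data

variable (D : Data m n K l) (x : Fin n → ℝ)

/-- The expected cost read off from the moments `(p_k, a_k)` of the parts of a distribution on
which the piece `k` is used. -/
def momentCost (Z : Fin K → ℝ × (Fin m → ℝ) × Matrix (Fin m) (Fin m) ℝ) : ℝ :=
  ∑ k, ((Z k).1 * (D.y₀ k x + D.y k x ⬝ᵥ D.μ) + (D.Lᵀ *ᵥ D.y k x) ⬝ᵥ (Z k).2.1)

/-- The slack `p_k (b - A μ) - A L a_k` of the homogenized support constraint. -/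
def slack (z : ℝ × (Fin m → ℝ) × Matrix (Fin m) (Fin m) ℝ) : Fin l → ℝ :=
  z.1 • (D.b - D.A *ᵥ D.μ) - D.A *ᵥ (D.L *ᵥ z.2.1)

end Data

/-- The mixture `∑ p_k δ_{ξ_k}`; negative weights count as `0`. -/
def atoms (p : Fin K → ℝ) (ξ : Fin K → Fin m → ℝ) : Measure (Fin m → ℝ) :=
  ∑ k, ENNReal.ofReal (p k) • Measure.dirac (ξ k)

lemma integrable_atoms (p : Fin K → ℝ) (ξ : Fin K → Fin m → ℝ) (g : (Fin m → ℝ) → ℝ) :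
    Integrable g (atoms p ξ) :=
  integrable_finsetSum_measure.2 fun _ _ =>
    (integrable_dirac enorm_lt_top).smul_measure ENNReal.ofReal_ne_top

lemma integral_atoms {p : Fin K → ℝ} (hp : ∀ k, 0 ≤ p k) (ξ : Fin K → Fin m → ℝ)
    (g : (Fin m → ℝ) → ℝ) : ∫ ζ, g ζ ∂(atoms p ξ) = ∑ k, p k * g (ξ k) := by
  rw [atoms, integral_finsetSum_measure fun _ _ =>
    (integrable_dirac enorm_lt_top).smul_measure ENNReal.ofReal_ne_top]
  refine Finset.sum_congr rfl fun k _ => ?_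
  rw [integral_smul_measure, integral_dirac, ENNReal.toReal_ofReal (hp k), smul_eq_mul]

lemma isProbabilityMeasure_atoms {p : Fin K → ℝ} (hp : ∀ k, 0 ≤ p k) (hp₁ : ∑ k, p k = 1)
    (ξ : Fin K → Fin m → ℝ) : IsProbabilityMeasure (atoms p ξ) := by
  refine ⟨?_⟩
  simp only [atoms, Measure.coe_finsetSum, Measure.coe_smul, Finset.sum_apply, Pi.smul_apply,
    measure_univ, smul_eq_mul, mul_one]
  rw [← ENNReal.ofReal_sum_of_nonneg fun k _ => hp k, hp₁, ENNReal.ofReal_one]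

lemma ae_atoms {p : Fin K → ℝ} (hp : ∀ k, 0 ≤ p k) {ξ : Fin K → Fin m → ℝ}
    {q : (Fin m → ℝ) → Prop} (h : ∀ k, 0 < p k → q (ξ k)) : ∀ᵐ ζ ∂(atoms p ξ), q ζ := by
  rw [ae_iff, atoms, Measure.finsetSum_apply]
  refine Finset.sum_eq_zero fun k _ => ?_
  rcases (hp k).eq_or_lt with h0 | h0
  · simp [← h0]
  · simp [Measure.dirac_apply, h k h0]

/-- A family of moments that satisfies the homogenized constraints is dominated by a distribution
in `𝓓_M`: put mass `p_k` at `a_k / p_k`. The atom moves to the origin when `p_k = 0`, but then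
`a_k = 0` and it carries no mass. -/
lemma Data.exists_mem_DM (D : Data m n K l) (x : Fin n → ℝ)
    {Z : Fin K → ℝ × (Fin m → ℝ) × Matrix (Fin m) (Fin m) ℝ} (hZ : ∀ k, Z k ∈ momentCone m)
    (hmass : ∑ k, (Z k).1 = 1) (hmean : (∑ k, (Z k).2.1) ⬝ᵥ (∑ k, (Z k).2.1) ≤ D.γ₁)
    (hcov : ∀ v, 0 ≤ v ⬝ᵥ (D.γ₂ • (1 : Matrix (Fin m) (Fin m) ℝ) - ∑ k, (Z k).2.2) *ᵥ v)
    (hslack : ∀ k, 0 ≤ D.slack (Z k)) : ∃ P ∈ D.DM, D.momentCost x Z ≤ D.cost x P := by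
  set p : Fin K → ℝ := fun k => (Z k).1 with hpdef
  set ξ : Fin K → Fin m → ℝ := fun k => (Z k).1⁻¹ • (Z k).2.1 with hξdef
  have hp (k : Fin K) : 0 ≤ p k := momentCone_mass_nonneg (hZ k)
  have hpξ (k : Fin K) : p k • ξ k = (Z k).2.1 := by
    rcases eq_or_ne (Z k).1 0 with h0 | h0
    · simp [hpdef, h0, momentCone_mean_eq_zero (hZ k) h0]
    · simp only [hpdef, hξdef, smul_smul, mul_inv_cancel₀ h0, one_smul]
  have hprob := isProbabilityMeasure_atoms hp hmass ξ
  refine ⟨⟨atoms p ξ, hprob⟩, ⟨?_, fun i => integrable_atoms _ _ _, ?_,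
    fun i j => integrable_atoms _ _ _, ?_⟩, ?_⟩
  · refine ae_atoms hp fun k hk i => ?_
    have h1 : (D.A *ᵥ (D.L *ᵥ (Z k).2.1)) i = p k * (D.A *ᵥ (D.L *ᵥ ξ k)) i := by
      rw [← hpξ k, mulVec_smul, mulVec_smul, Pi.smul_apply, smul_eq_mul]
    have h2 := hslack k i
    simp only [slack, Pi.zero_apply, Pi.sub_apply, Pi.smul_apply, smul_eq_mul, h1] at h2
    rw [mulVec_add, Pi.add_apply]
    have h3 : 0 ≤ p k * (D.b i - (D.A *ᵥ D.μ) i - (D.A *ᵥ (D.L *ᵥ ξ k)) i) := by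
      rw [mul_sub]; exact h2
    have := nonneg_of_mul_nonneg_right h3 hk
    linarith
  · have : meanVec (atoms p ξ) = ∑ k, (Z k).2.1 := by
      ext i
      rw [meanVec, integral_atoms hp ξ (fun ζ => ζ i), Finset.sum_apply]
      exact Finset.sum_congr rfl fun k _ => congrFun (hpξ k) i
    simpa [this] using hmean
  · have hM : secondMoment (atoms p ξ) (fun ζ => ζ) = ∑ k, p k • vecMulVec (ξ k) (ξ k) := by
      ext i j
      rw [secondMoment, of_apply, integral_atoms hp ξ (fun ζ => ζ i * ζ j), Matrix.sum_apply]
      rfl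
    change (D.γ₂ • (1 : Matrix (Fin m) (Fin m) ℝ) -
      secondMoment (atoms p ξ) (fun ζ => ζ)).PosSemidef
    rw [hM, posSemidef_iff_dotProduct_mulVec]
    refine ⟨?_, fun v => ?_⟩
    · ext i j
      simp only [conjTranspose_apply, Matrix.sub_apply, Matrix.smul_apply, Matrix.sum_apply,
        vecMulVec_apply, Matrix.one_apply, eq_comm (a := j), star_trivial, mul_comm (ξ _ j)]
    · refine (hcov v).trans ?_
      rw [star_trivial, sub_mulVec, sub_mulVec, dotProduct_sub, dotProduct_sub]
      refine sub_le_sub_left ?_ _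
      rw [sum_mulVec, sum_mulVec, dotProduct_sum, dotProduct_sum]
      refine Finset.sum_le_sum fun k _ => le_trans (le_of_eq ?_) (momentCone_schur (hZ k) v)
      rw [smul_mulVec, vecMulVec_mulVec, dotProduct_smul, op_smul_eq_smul, dotProduct_smul,
        dotProduct_comm v (ξ k), smul_eq_mul, smul_eq_mul]
      rcases eq_or_ne (Z k).1 0 with h0 | h0
      · simp [hpdef, h0]
      · simp only [hpdef, hξdef, smul_dotProduct, smul_eq_mul]
        field_simp
  · change _ ≤ ∫ ζ, D.f x (D.L *ᵥ ζ + D.μ) ∂(atoms p ξ)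
    rw [integral_atoms hp, momentCost]
    refine Finset.sum_le_sum fun k _ => ?_
    calc _ = p k * (D.y₀ k x + D.y k x ⬝ᵥ (D.L *ᵥ ξ k + D.μ)) := by
          rw [piece_eq, ← hpξ k, dotProduct_smul, smul_eq_mul, hpdef]
          ring
      _ ≤ _ := mul_le_mul_of_nonneg_left (D.le_f x _ k) (hp k)

/-! ### Strong duality -/

/-- The variables `(s, λ̂, q, Q)` of the original program without the decision `x`. -/
abbrev DualVar (m K l : ℕ) : Type :=
  ℝ × (Fin K → Fin l → ℝ) × (Fin m → ℝ) × Matrix (Fin m) (Fin m) ℝ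

namespace Data

variable (D : Data m n K l) (x : Fin n → ℝ)

/-- The objective of the original program minus the pairing of the moments with its semidefinite
constraints. -/
def lagrangian (Z : Fin K → ℝ × (Fin m → ℝ) × Matrix (Fin m) (Fin m) ℝ)
    (d : DualVar m K l) : ℝ :=
  d.1 + D.γ₂ * d.2.2.2.trace + √D.γ₁ * ‖WithLp.toLp 2 d.2.2.1‖ -
    ∑ k, ((Z k).1 * D.corner x d.1 d.2.1 k + (d.2.2.1 + D.shift x d.2.1 k) ⬝ᵥ (Z k).2.1 +
      (d.2.2.2 * (Z k).2.2).trace)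

/-- The Lagrangian regrouped: the expected cost, plus the pairing of the variables of the original
program with the constraints on the moments. -/
lemma lagrangian_eq (Z : Fin K → ℝ × (Fin m → ℝ) × Matrix (Fin m) (Fin m) ℝ)
    (d : DualVar m K l) :
    D.lagrangian x Z d = D.momentCost x Z + d.1 * (1 - ∑ k, (Z k).1) +
      (√D.γ₁ * ‖WithLp.toLp 2 d.2.2.1‖ - d.2.2.1 ⬝ᵥ ∑ k, (Z k).2.1) +
      (d.2.2.2 * (D.γ₂ • 1 - ∑ k, (Z k).2.2)).trace + ∑ k, d.2.1 k ⬝ᵥ D.slack (Z k) := by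
  have h (k : Fin K) : D.shift x d.2.1 k ⬝ᵥ (Z k).2.1 =
      d.2.1 k ⬝ᵥ D.A *ᵥ (D.L *ᵥ (Z k).2.1) - (D.Lᵀ *ᵥ D.y k x) ⬝ᵥ (Z k).2.1 := by
    rw [shift, mulVec_sub, sub_dotProduct, dotProduct_mulVec_symm D.A, dotProduct_mulVec_symm D.L]
  have h2 (k : Fin K) : (Z k).1 * D.corner x d.1 d.2.1 k +
      (d.2.2.1 + D.shift x d.2.1 k) ⬝ᵥ (Z k).2.1 + (d.2.2.2 * (Z k).2.2).trace =
      d.1 * (Z k).1 + d.2.2.1 ⬝ᵥ (Z k).2.1 + (d.2.2.2 * (Z k).2.2).trace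
        - ((Z k).1 * (D.y₀ k x + D.y k x ⬝ᵥ D.μ) + (D.Lᵀ *ᵥ D.y k x) ⬝ᵥ (Z k).2.1)
        - d.2.1 k ⬝ᵥ D.slack (Z k) := by
    rw [add_dotProduct, h, corner, slack, dotProduct_sub, dotProduct_smul, dotProduct_sub,
      smul_eq_mul]
    ring
  have h3 : (d.2.2.2 * (D.γ₂ • 1 - ∑ k, (Z k).2.2)).trace =
      D.γ₂ * d.2.2.2.trace - ∑ k, (d.2.2.2 * (Z k).2.2).trace := by
    rw [Matrix.mul_sub, trace_sub, Matrix.mul_sum, trace_sum, Matrix.mul_smul, Matrix.mul_one,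
      trace_smul, smul_eq_mul]
  rw [lagrangian, h3, dotProduct_sum, Finset.sum_congr rfl fun k _ => h2 k,
    Finset.sum_sub_distrib, Finset.sum_sub_distrib, Finset.sum_add_distrib,
    Finset.sum_add_distrib, ← Finset.mul_sum, momentCost]
  ring

lemma continuous_lagrangian_left (d : DualVar m K l) : Continuous fun Z => D.lagrangian x Z d := by
  unfold lagrangian
  fun_prop

lemma continuous_lagrangian_right
    (Z : Fin K → ℝ × (Fin m → ℝ) × Matrix (Fin m) (Fin m) ℝ) :
    Continuous fun d => D.lagrangian x Z d := by
  simp only [lagrangian_eq]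
  have : Continuous fun d : DualVar m K l => WithLp.toLp 2 d.2.2.1 :=
    (PiLp.continuous_toLp 2 _).comp (by fun_prop)
  fun_prop

lemma lagrangian_combo_left (d : DualVar m K l)
    (Z Z' : Fin K → ℝ × (Fin m → ℝ) × Matrix (Fin m) (Fin m) ℝ) {α β : ℝ} (h : α + β = 1) :
    D.lagrangian x (α • Z + β • Z') d = α * D.lagrangian x Z d + β * D.lagrangian x Z' d := by
  obtain rfl : β = 1 - α := by linarith
  set c := d.1 + D.γ₂ * d.2.2.2.trace + √D.γ₁ * ‖WithLp.toLp 2 d.2.2.1‖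
  have hc : c = α * c + (1 - α) * c := by ring
  rw [lagrangian, lagrangian, lagrangian, mul_sub, mul_sub, sub_add_sub_comm, ← hc,
    Finset.mul_sum, Finset.mul_sum, ← Finset.sum_add_distrib]
  congr 1
  refine Finset.sum_congr rfl fun k _ => ?_
  simp only [Pi.add_apply, Pi.smul_apply, Prod.fst_add, Prod.snd_add, Prod.smul_fst,
    Prod.smul_snd, dotProduct_add, dotProduct_smul, Matrix.mul_add, Matrix.mul_smul, trace_add,
    trace_smul, smul_eq_mul]
  ring

lemma lagrangian_combo_right_le (Z : Fin K → ℝ × (Fin m → ℝ) × Matrix (Fin m) (Fin m) ℝ)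
    (d d' : DualVar m K l) {α β : ℝ} (hα : 0 ≤ α) (hβ : 0 ≤ β) (h : α + β = 1) :
    D.lagrangian x Z (α • d + β • d') ≤ α * D.lagrangian x Z d + β * D.lagrangian x Z d' := by
  have hn : ‖WithLp.toLp 2 (α • d + β • d').2.2.1‖ ≤
      α * ‖WithLp.toLp 2 d.2.2.1‖ + β * ‖WithLp.toLp 2 d'.2.2.1‖ := by
    have := norm_add_le (α • WithLp.toLp 2 d.2.2.1) (β • WithLp.toLp 2 d'.2.2.1)
    rwa [norm_smul, norm_smul, Real.norm_of_nonneg hα, Real.norm_of_nonneg hβ] at this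
  have hn' := mul_le_mul_of_nonneg_left hn (Real.sqrt_nonneg D.γ₁)
  have hc : D.momentCost x Z = α * D.momentCost x Z + β * D.momentCost x Z := by
    rw [← add_mul, h, one_mul]
  have hs : ∑ k, (α • d + β • d').2.1 k ⬝ᵥ D.slack (Z k) =
      α * ∑ k, d.2.1 k ⬝ᵥ D.slack (Z k) + β * ∑ k, d'.2.1 k ⬝ᵥ D.slack (Z k) := by
    simp only [Finset.mul_sum, ← Finset.sum_add_distrib]
    refine Finset.sum_congr rfl fun k _ => ?_
    simp [add_dotProduct, smul_dotProduct]
  rw [lagrangian_eq, lagrangian_eq, lagrangian_eq, hs]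
  simp only [Prod.fst_add, Prod.snd_add, Prod.smul_fst, Prod.smul_snd, add_dotProduct,
    smul_dotProduct, Matrix.add_mul, Matrix.smul_mul, trace_add, trace_smul, smul_eq_mul] at hn' ⊢
  linarith

end Data

/-- The cone `λ̂ ≥ 0`, `Q ⪰ 0` over which the Lagrangian is minimized. -/
def dualCone (m K l : ℕ) : Set (DualVar m K l) :=
  {d | (∀ k, 0 ≤ d.2.1 k) ∧ d.2.2.2.PosSemidef}

lemma convex_dualCone : Convex ℝ (dualCone m K l) := by
  rintro d ⟨h1, h2⟩ d' ⟨h1', h2'⟩ α β hα hβ -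
  exact ⟨fun k => add_nonneg (smul_nonneg hα (h1 k)) (smul_nonneg hβ (h1' k)),
    (h2.smul hα).add (h2'.smul hβ)⟩

lemma nonneg_of_forall_le_add_mul {r α β : ℝ} (h : ∀ t : ℝ, 0 ≤ t → r ≤ α + t * β) : 0 ≤ β := by
  by_contra! hβ
  have h1 := h ((|α - r| + 1) / -β) (by have := neg_pos.2 hβ; positivity)
  have h2 : (|α - r| + 1) / -β * β = -(|α - r| + 1) := by
    rw [div_mul_eq_mul_div, div_neg, mul_div_cancel_right₀ _ hβ.ne]
  have := le_abs_self (α - r)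
  linarith

namespace Data

variable (D : Data m n K l) (x : Fin n → ℝ)

/-- A family of moments whose Lagrangian is bounded below satisfies all the constraints: otherwise
the Lagrangian tends to `-∞` along a ray of the dual cone. -/
lemma exists_le_cost_of_forall_le_lagrangian (hγ₁ : 0 ≤ D.γ₁)
    {Z : Fin K → ℝ × (Fin m → ℝ) × Matrix (Fin m) (Fin m) ℝ} (hZ : ∀ k, Z k ∈ momentCone m)
    {r : ℝ} (h : ∀ d ∈ dualCone m K l, r ≤ D.lagrangian x Z d) :
    ∃ P ∈ D.DM, r ≤ D.cost x P := by
  simp only [lagrangian_eq] at h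
  have hmass : ∑ k, (Z k).1 = 1 := by
    have h1 := nonneg_of_forall_le_add_mul (r := r) (α := D.momentCost x Z)
      (β := 1 - ∑ k, (Z k).1) fun t _ => by
        simpa using h (t, 0, 0, 0) ⟨fun _ => le_rfl, PosSemidef.zero⟩
    have h2 := nonneg_of_forall_le_add_mul (r := r) (α := D.momentCost x Z)
      (β := -(1 - ∑ k, (Z k).1)) fun t _ => by
        have := h (-t, 0, 0, 0) ⟨fun _ => le_rfl, PosSemidef.zero⟩
        simp at this
        linarith
    linarith
  have hmean : (∑ k, (Z k).2.1) ⬝ᵥ (∑ k, (Z k).2.1) ≤ D.γ₁ := by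
    set a := ∑ k, (Z k).2.1
    have h1 := nonneg_of_forall_le_add_mul (r := r) (α := D.momentCost x Z)
      (β := √D.γ₁ * ‖WithLp.toLp 2 a‖ - a ⬝ᵥ a) fun t ht => by
        have := h (0, 0, t • a, 0) ⟨fun _ => le_rfl, PosSemidef.zero⟩
        simp only [WithLp.toLp_smul, norm_smul, Real.norm_of_nonneg ht, smul_dotProduct,
          smul_eq_mul] at this
        simp at this
        linarith
    rw [← norm_toLp_sq] at h1 ⊢
    have h2 : ‖WithLp.toLp 2 a‖ ≤ √D.γ₁ := by
      by_contra! hlt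
      nlinarith [Real.sqrt_nonneg D.γ₁]
    calc _ ≤ √D.γ₁ ^ 2 := by gcongr
      _ = D.γ₁ := Real.sq_sqrt hγ₁
  have hcov (v : Fin m → ℝ) :
      0 ≤ v ⬝ᵥ (D.γ₂ • (1 : Matrix (Fin m) (Fin m) ℝ) - ∑ k, (Z k).2.2) *ᵥ v := by
    refine nonneg_of_forall_le_add_mul (r := r) (α := D.momentCost x Z) fun t ht => ?_
    have hpsd : (t • vecMulVec v v).PosSemidef := by
      simpa using (posSemidef_vecMulVec_self_star v).smul ht
    have := h (0, 0, 0, t • vecMulVec v v) ⟨fun _ => le_rfl, hpsd⟩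
    rw [Matrix.smul_mul, trace_smul, trace_mul_comm, mul_vecMulVec, trace_vecMulVec,
      dotProduct_comm _ v] at this
    simpa using this
  have hslack (k : Fin K) : 0 ≤ D.slack (Z k) := fun j => by
    refine nonneg_of_forall_le_add_mul (r := r) (α := D.momentCost x Z) fun t ht => ?_
    have hnn : (0 : Fin K → Fin l → ℝ) ≤ Pi.single k (Pi.single j t) :=
      Pi.single_nonneg.2 (Pi.single_nonneg.2 ht)
    have hsum : ∑ k', (Pi.single k (Pi.single j t) : Fin K → Fin l → ℝ) k' ⬝ᵥ D.slack (Z k') =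
        t * D.slack (Z k) j := by
      rw [Finset.sum_eq_single k (fun k' _ hk' => by simp [Pi.single_eq_of_ne hk']) (by simp)]
      simp
    have := h (0, Pi.single k (Pi.single j t), 0, 0) ⟨hnn, PosSemidef.zero⟩
    rw [hsum] at this
    simpa using this
  obtain ⟨P, hP, hle⟩ := D.exists_mem_DM x hZ hmass hmean hcov hslack
  refine ⟨P, hP, le_trans ?_ hle⟩
  simpa using h 0 ⟨fun _ => le_rfl, PosSemidef.zero⟩

/-- The minimax step: on a compact set of families of moments, one choice of the variables of the
original program keeps the Lagrangian below any bound that exceeds the worst-case cost. -/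
lemma exists_forall_lagrangian_lt (hγ₁ : 0 ≤ D.γ₁) {R r : ℝ} (hR : 0 ≤ R)
    (hr : ∀ P ∈ D.DM, D.cost x P < r) :
    ∃ d ∈ dualCone m K l, ∀ Z ∈ momentFamilies m K R, D.lagrangian x Z d < r := by
  have hcomp := isCompact_momentFamilies (m := m) (K := K) R
  obtain ⟨T, hT, hTfin, hcover⟩ := hcomp.elim_finite_subcover_image (b := dualCone m K l)
    (c := fun d => {Z | D.lagrangian x Z d < r})
    (fun d _ => isOpen_lt (D.continuous_lagrangian_left x d) continuous_const)
    (fun Z hZ => by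
      by_contra hcon
      simp only [Set.mem_iUnion, not_exists] at hcon
      obtain ⟨P, hP, hle⟩ := D.exists_le_cost_of_forall_le_lagrangian x hγ₁ hZ.1
        fun d hd => not_lt.1 (hcon d hd)
      exact (hr P hP).not_ge hle)
  have hconvex (Z : Fin K → ℝ × (Fin m → ℝ) × Matrix (Fin m) (Fin m) ℝ) :
      ConcaveOn ℝ (dualCone m K l) fun d => -D.lagrangian x Z d := by
    refine ⟨convex_dualCone, fun d _ d' _ α β hα hβ hαβ => ?_⟩
    have := D.lagrangian_combo_right_le x Z d d' hα hβ hαβ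
    simp only [smul_eq_mul]
    linarith
  have hconvex' (d : DualVar m K l) :
      ConvexOn ℝ (momentFamilies m K R) fun Z => -D.lagrangian x Z d := by
    refine ⟨convex_momentFamilies R, fun Z _ Z' _ α β _ _ hαβ => ?_⟩
    have := D.lagrangian_combo_left x d Z Z' hαβ
    simp only [smul_eq_mul]
    linarith
  obtain ⟨d, hd, hlt⟩ := Sion.exists_lt_iInf_of_lt_iInf_of_finite
    (X := momentFamilies m K R) (Y := dualCone m K l) (f := fun Z d => -D.lagrangian x Z d)
    ⟨0, fun _ => ⟨isHermitian_zero, by simp⟩, by simpa using hR⟩ hcomp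
    (fun d _ => (D.continuous_lagrangian_left x d).neg.lowerSemicontinuous.lowerSemicontinuousOn _)
    (fun d _ => (hconvex' d).quasiconvexOn) convex_dualCone
    (fun Z _ => (D.continuous_lagrangian_right x Z).neg.upperSemicontinuous.upperSemicontinuousOn _)
    (fun Z _ => (hconvex Z).quasiconcaveOn) (convex_momentFamilies R) hTfin hT (t := -r)
    (fun Z hZ => by
      obtain ⟨d, hd, hlt⟩ := Set.mem_iUnion₂.1 (hcover hZ)
      exact ⟨d, hd, neg_lt_neg hlt⟩)
  exact ⟨d, hd, fun Z hZ => neg_lt_neg_iff.1 (hlt Z hZ)⟩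

/-- Strong duality for a fixed decision. It needs no constraint qualification, because the set of
moments is compact: with `R = 1 + γ₂ m`, the minimax step gives variables whose block matrices are
bounded below by `-ε`, and raising `s` by `ε` and `Q` by `ε I` makes them positive semidefinite at
the cost `ε R`. -/
lemma exists_mainFeasible_of_forall_cost_lt (hγ₁ : 0 ≤ D.γ₁) (hγ₂ : 0 ≤ D.γ₂) (hx : x ∈ D.X)
    {r : ℝ} (hr : ∀ P ∈ D.DM, D.cost x P < r) : ∃ z, D.MainFeasible z ∧ D.mainObj z ≤ r := by
  set R : ℝ := 1 + D.γ₂ * m with hRdef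
  have hR : 0 < R := by positivity
  obtain ⟨d, ⟨hlam, hQ⟩, hd⟩ := D.exists_forall_lagrangian_lt x hγ₁ hR.le hr
  set obj : ℝ := d.1 + D.γ₂ * d.2.2.2.trace + √D.γ₁ * ‖WithLp.toLp 2 d.2.2.1‖ with hobj
  have hobj_lt : obj < r := by
    have := hd 0 ⟨fun _ => ⟨isHermitian_zero, by simp⟩, by simpa using hR.le⟩
    simpa [lagrangian] using this
  set ε : ℝ := (r - obj) / R with hε
  have hεR : ε * R = r - obj := div_mul_cancel₀ _ hR.ne'
  refine ⟨⟨x, d.1 + ε, d.2.1, d.2.2.1, d.2.2.2 + ε • 1⟩, ⟨hx, hlam, fun k => ?_⟩, ?_⟩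
  · rw [blockMatrix_posSemidef_iff]
    refine ⟨hQ.isHermitian.add ?_, fun t v => ?_⟩
    · simp [Matrix.IsHermitian]
    have hcorner : D.corner x (d.1 + ε) d.2.1 k = D.corner x d.1 d.2.1 k + ε := by
      simp only [corner]; ring
    rw [hcorner, add_mulVec, dotProduct_add, smul_mulVec, one_mulVec, dotProduct_smul, smul_eq_mul]
    set φ : ℝ := D.corner x d.1 d.2.1 k * t ^ 2 + t * ((d.2.2.1 + D.shift x d.2.1 k) ⬝ᵥ v) +
      v ⬝ᵥ d.2.2.2 *ᵥ v with hφ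
    suffices 0 ≤ φ + ε * (t ^ 2 + v ⬝ᵥ v) by rw [hφ] at this; linarith
    have hv : 0 ≤ v ⬝ᵥ v := by rw [← norm_toLp_sq]; positivity
    rcases (add_nonneg (sq_nonneg t) hv).eq_or_lt with h0 | h0
    · have ht : t = 0 := pow_eq_zero_iff two_ne_zero |>.1 (by linarith [sq_nonneg t])
      have hv0 : v = 0 := dotProduct_self_eq_zero.1 (by linarith [sq_nonneg t])
      simp [hφ, ht, hv0]
    -- Test the Lagrangian on the rank-one family of total trace `R` supported at the index `k`.
    set c : ℝ := R / (t ^ 2 + v ⬝ᵥ v) with hc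
    have hcpos : 0 < c := div_pos hR h0
    have hcR : c * (t ^ 2 + v ⬝ᵥ v) = R := div_mul_cancel₀ _ h0.ne'
    set ζ : ℝ × (Fin m → ℝ) × Matrix (Fin m) (Fin m) ℝ :=
      (c * t ^ 2, (c * t) • v, c • vecMulVec v v) with hζ
    have hmem : (Pi.single k ζ : Fin K → _) ∈ momentFamilies m K R := by
      refine ⟨fun k' => ?_, ?_⟩
      · rcases eq_or_ne k' k with rfl | hk
        · rw [Pi.single_eq_same]
          exact rankOne_mem_momentCone hcpos.le t v
        · rw [Pi.single_eq_of_ne hk]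
          exact ⟨isHermitian_zero, by simp⟩
      · rw [Finset.sum_eq_single k (fun k' _ hk' => by simp [Pi.single_eq_of_ne hk']) (by simp),
          Pi.single_eq_same, hζ, trace_smul, trace_vecMulVec, smul_eq_mul, ← mul_add, hcR]
    have hlt := hd _ hmem
    rw [lagrangian, Finset.sum_eq_single k (fun k' _ hk' => by simp [Pi.single_eq_of_ne hk'])
      (by simp), Pi.single_eq_same, hζ, Matrix.mul_smul, trace_smul, mul_vecMulVec,
      trace_vecMulVec, dotProduct_comm _ v, dotProduct_smul, smul_eq_mul, smul_eq_mul] at hlt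
    have h1 : -(ε * R) < c * φ := by rw [hεR, hφ]; linarith
    rw [← hcR] at h1
    have h2 : 0 < c * (φ + ε * (t ^ 2 + v ⬝ᵥ v)) := by linarith
    exact (pos_of_mul_pos_right h2 hcpos.le).le
  · simp only [mainObj, trace_add, trace_smul, trace_one, Fintype.card_fin, smul_eq_mul]
    refine le_of_eq ?_
    linear_combination hεR

end Data

/-! ### Comparison of the optimal values -/

namespace Data

variable (D : Data m n K l)

/-- A lower bound for the original semidefinite program is a lower bound for `Θ_M`. -/
lemma le_thetaM (hγ₁ : 0 ≤ D.γ₁) (hγ₂ : 0 ≤ D.γ₂) {v : EReal}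
    (hv : ∀ z, D.MainFeasible z → v ≤ (D.mainObj z : EReal)) : v ≤ D.thetaM := by
  refine le_iInf₂ fun x hx => ?_
  by_contra! hlt
  obtain ⟨r, h1, h2⟩ := EReal.lt_iff_exists_real_btwn.1 hlt
  obtain ⟨z, hz, hobj⟩ := D.exists_mainFeasible_of_forall_cost_lt x hγ₁ hγ₂ hx (r := r)
    fun P hP => EReal.coe_lt_coe_iff.1 ((le_iSup₂_of_le P hP le_rfl).trans_lt h1)
  exact ((hv z hz).trans (EReal.coe_le_coe_iff.2 hobj)).not_gt h2

lemma thetaM_le_thetaU (r : ℕ) : D.thetaM ≤ D.thetaU r :=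
  le_iInf₂ fun _ hB => D.thetaM_le_thetaBar hB

lemma thetaU_le_thetaUSDP (hK : 1 ≤ K) (r : ℕ) : D.thetaU r ≤ D.thetaUSDP r :=
  iInf₂_mono fun _ _ => le_iInf₂ fun _ hw => D.thetaBar_le_innerObj hK hw

/-- With `K` directions at hand, the inner program attains the objective of every feasible point
of the original program: choose `B` so that its range contains the vectors `shift`. -/
lemma thetaUSDP_le_mainObj (hK : 1 ≤ K) (hγ₂ : 0 ≤ D.γ₂) {r : ℕ} (hKr : K ≤ r) (hrm : r ≤ m)
    {z : MainPoint m n K l} (hz : D.MainFeasible z) :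
    D.thetaUSDP r ≤ (D.mainObj z : EReal) := by
  obtain ⟨B, hB, hc⟩ := exists_orthoFrame hKr hrm (D.shift z.x z.lam)
  exact (iInf₂_le B hB).trans <| (iInf₂_le _ (D.innerFeasible_compress hz hc)).trans <|
    EReal.coe_le_coe_iff.2 (D.innerObj_compress_le hK hγ₂ hB hz)

lemma thetaUSDP_le_thetaM (hK : 1 ≤ K) (hγ₁ : 0 ≤ D.γ₁) (hγ₂ : 0 ≤ D.γ₂) {r : ℕ} (hKr : K ≤ r)
    (hrm : r ≤ m) : D.thetaUSDP r ≤ D.thetaM :=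
  D.le_thetaM hγ₁ hγ₂ fun _ hz => D.thetaUSDP_le_mainObj hK hγ₂ hKr hrm hz

/-- Projecting an optimal solution to a `K`-dimensional space that contains the vectors `shift`
keeps it feasible and does not raise the objective. -/
lemma exists_lowRankForm (hK : 1 ≤ K) (hKm : K ≤ m) (hγ₂ : 0 ≤ D.γ₂) {z : MainPoint m n K l}
    (hz : D.MainOptimal z) :
    ∃ (q' : Fin m → ℝ) (Q' : Matrix (Fin m) (Fin m) ℝ) (V : Matrix (Fin m) (Fin K) ℝ)
      (δ : Fin K → ℝ) (Y₁₁ : Matrix (Fin K) (Fin K) ℝ) (ν : Fin K → Fin K → ℝ),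
      D.LowRankForm ⟨z.x, z.s, z.lam, q', Q'⟩ V δ Y₁₁ ν := by
  obtain ⟨V, hV, hc⟩ := exists_orthoFrame le_rfl hKm (D.shift z.x z.lam)
  have hw := D.innerFeasible_compress hz.1 hc
  refine ⟨V *ᵥ (Vᵀ *ᵥ z.q), V * (Vᵀ * z.Q * V) * Vᵀ, V, Vᵀ *ᵥ z.q, Vᵀ * z.Q * V,
    fun k => Vᵀ *ᵥ D.shift z.x z.lam k, ⟨D.mainFeasible_lift hw, fun z' hz' => ?_⟩, hV, rfl,
    posSemidef_of_blockMatrix (hw.2.2.1 ⟨0, hK⟩), rfl, fun k => (hc k).symm⟩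
  calc _ = D.innerObj (D.compress V z) := D.mainObj_lift hV _
    _ ≤ D.mainObj z := D.innerObj_compress_le hK hγ₂ hV hz.1
    _ ≤ _ := hz.2 z' hz'

/-- The compression of a solution in low-rank form is optimal for the inner program, whose value
`Θ_U(K)` it attains. -/
lemma exists_innerOptimal_of_lowRankForm (hK : 1 ≤ K) (hγ₁ : 0 ≤ D.γ₁) (hγ₂ : 0 ≤ D.γ₂)
    {z : MainPoint m n K l} {V : Matrix (Fin m) (Fin K) ℝ} {δ : Fin K → ℝ}
    {Y₁₁ : Matrix (Fin K) (Fin K) ℝ} {ν : Fin K → Fin K → ℝ} (h : D.LowRankForm z V δ Y₁₁ ν) :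
    D.thetaU K = D.thetaBar V ∧
      ∃ w : InnerPoint m n K l K,
        w.Qr = Y₁₁ ∧ D.InnerOptimal V w ∧ (D.innerObj w : EReal) = D.thetaU K := by
  obtain ⟨hz, hV, -, -, hQ, hν⟩ := h
  have hV' : Vᵀ * V = 1 := hV
  have hc (k : Fin K) : V *ᵥ (Vᵀ *ᵥ D.shift z.x z.lam k) = D.shift z.x z.lam k := by
    rw [hν, mulVec_mulVec _ Vᵀ V, hV', one_mulVec]
  have hw := D.innerFeasible_compress hz.1 hc
  have hobj := D.innerObj_compress_le hK hγ₂ hV hz.1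
  have hM : (D.innerObj (D.compress V z) : EReal) ≤ D.thetaM :=
    D.le_thetaM hγ₁ hγ₂ fun z' hz' => EReal.coe_le_coe_iff.2 (hobj.trans (hz.2 z' hz'))
  have hU := hM.trans (D.thetaM_le_thetaU K)
  have hbar := D.thetaBar_le_innerObj hK hw
  have hUbar : D.thetaU K ≤ D.thetaBar V := iInf₂_le V hV
  refine ⟨le_antisymm hUbar (hbar.trans hU), D.compress V z, ?_,
    ⟨hV, hw, fun B' hB' w' hw' => ?_⟩, le_antisymm hU (hUbar.trans hbar)⟩
  · change Vᵀ * z.Q * V = Y₁₁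
    rw [hQ, Matrix.mul_assoc V, ← Matrix.mul_assoc Vᵀ V, hV', Matrix.one_mul, Matrix.mul_assoc,
      hV', Matrix.mul_one]
  · rw [← D.mainObj_lift hB' w']
    exact hobj.trans (hz.2 _ (D.mainFeasible_lift hw'))

end Data

end ODR

end

theorem theorem5 {m n K l : ℕ} (D : ODR.Data m n K l)
    (hK : 1 ≤ K) (hγ₁ : 0 ≤ D.γ₁) (hγ₂ : 1 ≤ D.γ₂)
    (hSig : D.Sig.PosDef) (hU : D.U.transpose * D.U = 1)
    (hdec : D.Sig = D.U * Matrix.diagonal D.Lam * D.U.transpose)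
    (hS : (interior D.S).Nonempty) :
    -- equality of the optimal values
    (∀ m₁ : ℕ, K ≤ m₁ → m₁ ≤ m → D.thetaU m₁ = D.thetaM ∧ D.thetaUSDP m₁ = D.thetaM) ∧
    -- every optimal solution of the original semidefinite program yields low-rank data
    (K ≤ m → ∀ z : ODR.MainPoint m n K l, D.MainOptimal z →
      ∃ (q' : Fin m → ℝ) (Q' : Matrix (Fin m) (Fin m) ℝ) (V : Matrix (Fin m) (Fin K) ℝ)
        (δ : Fin K → ℝ) (Y₁₁ : Matrix (Fin K) (Fin K) ℝ) (ν : Fin K → Fin K → ℝ),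
        D.LowRankForm ⟨z.x, z.s, z.lam, q', Q'⟩ V δ Y₁₁ ν) ∧
    -- for `m₁ = K`, all such data give an optimal `B = V` and `Q_r = Y₁₁`
    (∀ (z : ODR.MainPoint m n K l) (V : Matrix (Fin m) (Fin K) ℝ) (δ : Fin K → ℝ)
      (Y₁₁ : Matrix (Fin K) (Fin K) ℝ) (ν : Fin K → Fin K → ℝ),
      D.LowRankForm z V δ Y₁₁ ν →
        D.thetaU K = D.thetaBar V ∧
        ∃ w : ODR.InnerPoint m n K l K,
          w.Qr = Y₁₁ ∧ D.InnerOptimal V w ∧ (D.innerObj w : EReal) = D.thetaU K) := by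
  have hγ₂' : 0 ≤ D.γ₂ := zero_le_one.trans hγ₂
  refine ⟨fun m₁ hKm₁ hm₁ => ?_, fun hKm z hz => D.exists_lowRankForm hK hKm hγ₂' hz,
    fun z V δ Y₁₁ ν h => D.exists_innerOptimal_of_lowRankForm hK hγ₁ hγ₂' h⟩
  have h1 := D.thetaM_le_thetaU m₁
  have h2 := D.thetaU_le_thetaUSDP hK m₁
  have h3 := D.thetaUSDP_le_thetaM hK hγ₁ hγ₂' hKm₁ hm₁
  exact ⟨le_antisymm (h2.trans h3) h1, le_antisymm h3 (h1.trans h2)⟩
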